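/- All rings are commutative and need not have a multiplicative identity. An \emph{$l_u$-ring} $(R,u)$ is a commutative ring $R$ with a lattice order compatible with addition such that $x,y\ge 0$ implies $xy\ge 0$, together with a strong unit $u$: $u\ge 0$ and for every $x\in R$ there is an integer $n\ge 0$ with $|x|\le nu$. It is \emph{semi-low} if $ab\le a\wedge b$ for all $a,b\in[0,u]$. An \emph{$l$-ideal} of $R$ is an additive subgroup $J$ such that $x\in J$ and $|y|\le|x|$ imply $y\in J$. A \emph{$PMV_f$-algebra} is an MV-algebra $(A,\oplus,\neg,0)$ with a commutative associative product such that, with $x\ominus y=\neg(\neg x\oplus y)$, $x\le y\iff x\ominus y=0$ and $x\wedge y=x\ominus(x\ominus y)$, one has $a0=0$, $a(b\oplus c)\le ab\oplus ac$, $ab\le a\wedge b$ and $a(b\ominus c)=ab\ominus ac$ for all $a,b,c\in A$. It is a \emph{$PMV_f$-chain} if this order is total. An \emph{ideal} of it is a nonempty subset $I$ that is downward closed, closed under $\oplus$ and absorbs products; $A/I$ is the quotient by the congruence $x\equiv_I y\iff (x\ominus y)\oplus(y\ominus x)\in I$, and $[x]_I$ denotes the class of $x$. An isomorphism of $PMV_f$-algebras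 is a bijection preserving $0,\oplus,\neg$ and the product. For a semi-low $l_u$-ring $(R,u)$, $\Gamma(R,u)$ is the segment $[0,u]=\{x\in R: 0\le x\le u\}$ with $x\oplus y=(x+y)\wedge u$, $\neg x=u-x$ and the product of $R$. \textbf{Theorem.} Let $(R,u)$ be a semi-low $l_u$-ring and let $J$ be an $l$-ideal of $R$. Let $R/J$ carry the induced operations $[x]_J+[y]_J=[x+y]_J$, $[x]_J[y]_J=[xy]_J$, $[x]_J\vee[y]_J=[x\vee y]_J$, $[x]_J\wedge[y]_J=[x\wedge y]_J$ (these are well defined). Then: \begin{enumerate} \item $(R/J,[u]_J)$ is a semi-low $l_u$-ring. \item $\Gamma(R,u)$ is a $PMV_f$-algebra, $J\cap[0,u]$ is an ideal of it, and both $\Gamma(R/J,[u]_J)$ and $\Gamma(R,u)/(J\cap[0,u])$ are $PMV_f$-algebras. \item There is an isomorphism of $PMV_f$-algebras $$\Theta\colon \Gamma(R/J,[u]_J)\to\Gamma(R,u)/(J\cap[0,u]),\qquad \Theta([x]_J)=[x]_{J\cap[0,u]}\quad(x\in[0,u]).$$ \item If $J$ is prime, i.e. $R/J$ is totally ordered,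 then $\Gamma(R/J,[u]_J)$ and $\Gamma(R,u)/(J\cap[0,u])$ are $PMV_f$-chains, so that $\Theta$ is an isomorphism of $PMV_f$-chains. \end{enumerate} -/

import Mathlib

namespace PMV

/-! ### MV-algebras with product -/

/-- The signature `(A, ⊕, ·, ¬, 0)` of MV-algebras with product (operations only, no laws). -/
class Sig (A : Type*) where
  zero : A
  oplus : A → A → A
  neg : A → A
  mul : A → A → A

section Operations

variable {A : Type*} [Sig A]

/-- The constant `0`. -/
def zer (A : Type*) [Sig A] : A := Sig.zero

/-- The largest element `u = ¬0`. -/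
def unit (A : Type*) [Sig A] : A := Sig.neg (zer A)

/-- `x ⊖ y = ¬(¬x ⊕ y)`. -/
def ominus (x y : A) : A := Sig.neg (Sig.oplus (Sig.neg x) y)

/-- `x ≤ y` iff `x ⊖ y = 0`. -/
def le (x y : A) : Prop := ominus x y = zer A

/-- The infimum `x ∧ y = x ⊖ (x ⊖ y)` in an MV-algebra. -/
def inf (x y : A) : A := ominus x (ominus x y)

end Operations

infixl:65 " ⊕ₘ " => Sig.oplus
infixl:65 " ⊖ₘ " => ominus
infixl:70 " *ₘ " => Sig.mul
infix:50 " ≤ₘ " => le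
infixl:68 " ⊓ₘ " => inf

/-- The laws of an MV-algebra (the product is ignored). -/
structure IsMVAlgebra (A : Type*) [Sig A] : Prop where
  oplus_assoc : ∀ x y z : A, x ⊕ₘ y ⊕ₘ z = x ⊕ₘ (y ⊕ₘ z)
  oplus_comm : ∀ x y : A, x ⊕ₘ y = y ⊕ₘ x
  oplus_zero : ∀ x : A, x ⊕ₘ zer A = x
  neg_neg : ∀ x : A, Sig.neg (Sig.neg x) = x
  oplus_unit : ∀ x : A, x ⊕ₘ unit A = unit A
  lukasiewicz : ∀ x y : A, Sig.neg (Sig.neg x ⊕ₘ y) ⊕ₘ y = Sig.neg (Sig.neg y ⊕ₘ x) ⊕ₘ x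

/-- Commutative MVW-rigs: MV-algebras with an associative commutative product satisfying
`a0 = 0`, `a(b ⊕ c) ≤ ab ⊕ ac` and `ab ⊖ ac ≤ a(b ⊖ c)`. -/
structure IsMVWRig (A : Type*) [Sig A] : Prop extends IsMVAlgebra A where
  mul_assoc : ∀ a b c : A, a *ₘ b *ₘ c = a *ₘ (b *ₘ c)
  mul_comm : ∀ a b : A, a *ₘ b = b *ₘ a
  mul_zero : ∀ a : A, a *ₘ zer A = zer A
  mul_oplus_le : ∀ a b c : A, a *ₘ (b ⊕ₘ c) ≤ₘ a *ₘ b ⊕ₘ a *ₘ c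
  ominus_le_mul : ∀ a b c : A, (a *ₘ b ⊖ₘ a *ₘ c) ≤ₘ a *ₘ (b ⊖ₘ c)

/-- `PMV_f`-algebras: MVW-rigs with `ab ≤ a ∧ b` and `a(b ⊖ c) = ab ⊖ ac`. -/
structure IsPMVf (A : Type*) [Sig A] : Prop extends IsMVWRig A where
  mul_le_inf : ∀ a b : A, a *ₘ b ≤ₘ a ⊓ₘ b
  mul_ominus : ∀ a b c : A, a *ₘ (b ⊖ₘ c) = a *ₘ b ⊖ₘ a *ₘ c

/-- `PMV_f`-chains: totally ordered `PMV_f`-algebras. -/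
structure IsPMVfChain (A : Type*) [Sig A] : Prop extends IsPMVf A where
  total : ∀ a b : A, a ≤ₘ b ∨ b ≤ₘ a

/-- Isomorphisms of MV-algebras with product (in particular of `PMV_f`-algebras):
bijections that preserve `0`, `⊕`, `¬` and `·`. -/
structure Iso (A B : Type*) [Sig A] [Sig B] extends A ≃ B where
  map_zero : toFun (zer A) = zer B
  map_oplus : ∀ x y : A, toFun (x ⊕ₘ y) = toFun x ⊕ₘ toFun y
  map_neg : ∀ x : A, toFun (Sig.neg x) = Sig.neg (toFun x)
  map_mul : ∀ x y : A, toFun (x *ₘ y) = toFun x *ₘ toFun y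

/-- Ideals of an MVW-rig: nonempty, downward closed, closed under `⊕`, absorbing products. -/
structure IsIdeal {A : Type*} [Sig A] (I : Set A) : Prop where
  nonempty : I.Nonempty
  mem_of_le : ∀ a b : A, a ≤ₘ b → b ∈ I → a ∈ I
  oplus_mem : ∀ a b : A, a ∈ I → b ∈ I → a ⊕ₘ b ∈ I
  mul_mem : ∀ a b : A, a ∈ I → a *ₘ b ∈ I

/-- The relation `x ≡_I y` iff `(x ⊖ y) ⊕ (y ⊖ x) ∈ I`. -/
def Rel {A : Type*} [Sig A] (I : Set A) (x y : A) : Prop := (x ⊖ₘ y) ⊕ₘ (y ⊖ₘ x) ∈ I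

section Congruence

variable {A : Type*} [Sig A]

theorem neg_unit (h : IsMVAlgebra A) : Sig.neg (unit A) = zer A := h.neg_neg _

theorem unit_oplus (h : IsMVAlgebra A) (x : A) : unit A ⊕ₘ x = unit A := by
  rw [h.oplus_comm, h.oplus_unit]

theorem neg_oplus_self (h : IsMVAlgebra A) (x : A) : Sig.neg x ⊕ₘ x = unit A := by
  have := h.lukasiewicz x (unit A)
  rw [h.oplus_unit, neg_unit h, h.oplus_comm (zer A), h.oplus_zero] at this
  exact this.symm

theorem le_iff (h : IsMVAlgebra A) (x y : A) : x ≤ₘ y ↔ Sig.neg x ⊕ₘ y = unit A := by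
  refine ⟨fun hxy => ?_, fun hxy => ?_⟩
  · rw [← h.neg_neg (Sig.neg x ⊕ₘ y)]
    exact congrArg Sig.neg hxy
  · unfold le ominus
    rw [hxy, neg_unit h]

theorem le_oplus (h : IsMVAlgebra A) (x z : A) : x ≤ₘ x ⊕ₘ z := by
  rw [le_iff h, ← h.oplus_assoc, neg_oplus_self h, unit_oplus h]

theorem exists_of_le (h : IsMVAlgebra A) {x y : A} (hxy : x ≤ₘ y) : ∃ z, y = x ⊕ₘ z := by
  have h1 := h.lukasiewicz x y
  rw [(le_iff h x y).1 hxy, neg_unit h, h.oplus_comm, h.oplus_zero] at h1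
  exact ⟨_, h1.trans (h.oplus_comm _ _)⟩

theorem le_rfl (h : IsMVAlgebra A) (x : A) : x ≤ₘ x := (le_iff h x x).2 (neg_oplus_self h x)

theorem le_trans (h : IsMVAlgebra A) {x y z : A} (hxy : x ≤ₘ y) (hyz : y ≤ₘ z) : x ≤ₘ z := by
  obtain ⟨a, rfl⟩ := exists_of_le h hxy
  obtain ⟨b, rfl⟩ := exists_of_le h hyz
  rw [h.oplus_assoc]
  exact le_oplus h _ _

theorem oplus_le_oplus_left (h : IsMVAlgebra A) (a : A) {x y : A} (hxy : x ≤ₘ y) :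
    a ⊕ₘ x ≤ₘ a ⊕ₘ y := by
  obtain ⟨b, rfl⟩ := exists_of_le h hxy
  rw [← h.oplus_assoc]
  exact le_oplus h _ _

theorem oplus_le_oplus (h : IsMVAlgebra A) {a b x y : A} (hab : a ≤ₘ b) (hxy : x ≤ₘ y) :
    a ⊕ₘ x ≤ₘ b ⊕ₘ y := by
  refine le_trans h (oplus_le_oplus_left h a hxy) ?_
  rw [h.oplus_comm a, h.oplus_comm b]
  exact oplus_le_oplus_left h y hab

theorem ominus_le_iff (h : IsMVAlgebra A) (x y z : A) : x ⊖ₘ y ≤ₘ z ↔ x ≤ₘ y ⊕ₘ z := by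
  rw [le_iff h, le_iff h]
  unfold ominus
  rw [h.neg_neg, h.oplus_assoc]

theorem le_oplus_ominus (h : IsMVAlgebra A) (x y : A) : x ≤ₘ y ⊕ₘ (x ⊖ₘ y) :=
  (ominus_le_iff h x y _).1 (le_rfl h _)

theorem rel_iff (h : IsMVAlgebra A) {I : Set A} (hI : IsIdeal I) (x y : A) :
    Rel I x y ↔ x ⊖ₘ y ∈ I ∧ y ⊖ₘ x ∈ I := by
  refine ⟨fun hr => ⟨hI.mem_of_le _ _ (le_oplus h _ _) hr, hI.mem_of_le _ _ ?_ hr⟩,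
    fun hr => hI.oplus_mem _ _ hr.1 hr.2⟩
  rw [h.oplus_comm]
  exact le_oplus h _ _

theorem ominus_trans_mem (h : IsMVAlgebra A) {I : Set A} (hI : IsIdeal I) {x y z : A}
    (hxy : x ⊖ₘ y ∈ I) (hyz : y ⊖ₘ z ∈ I) : x ⊖ₘ z ∈ I := by
  refine hI.mem_of_le _ _ ?_ (hI.oplus_mem _ _ hyz hxy)
  rw [ominus_le_iff h, ← h.oplus_assoc]
  refine le_trans h (le_oplus_ominus h x y) (oplus_le_oplus h (le_oplus_ominus h y z) (le_rfl h _))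

theorem oplus_ominus_mem (h : IsMVAlgebra A) {I : Set A} (hI : IsIdeal I) {x y a b : A}
    (hxy : x ⊖ₘ y ∈ I) (hab : a ⊖ₘ b ∈ I) : (x ⊕ₘ a) ⊖ₘ (y ⊕ₘ b) ∈ I := by
  refine hI.mem_of_le _ _ ?_ (hI.oplus_mem _ _ hxy hab)
  rw [ominus_le_iff h]
  have e : y ⊕ₘ b ⊕ₘ ((x ⊖ₘ y) ⊕ₘ (a ⊖ₘ b)) = (y ⊕ₘ (x ⊖ₘ y)) ⊕ₘ (b ⊕ₘ (a ⊖ₘ b)) := by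
    rw [h.oplus_assoc, h.oplus_assoc, ← h.oplus_assoc b, h.oplus_comm b, h.oplus_assoc]
  rw [e]
  exact oplus_le_oplus h (le_oplus_ominus h x y) (le_oplus_ominus h a b)

theorem neg_ominus_neg (h : IsMVAlgebra A) (x y : A) : Sig.neg x ⊖ₘ Sig.neg y = y ⊖ₘ x := by
  unfold ominus
  rw [h.neg_neg, h.oplus_comm]

theorem mul_ominus_mem (h : IsMVWRig A) {I : Set A} (hI : IsIdeal I) {x y : A} (c : A)
    (hxy : x ⊖ₘ y ∈ I) : (c *ₘ x) ⊖ₘ (c *ₘ y) ∈ I := by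
  refine hI.mem_of_le _ _ (h.ominus_le_mul c x y) ?_
  rw [h.mul_comm]
  exact hI.mul_mem _ _ hxy

theorem rel_equivalence (h : IsMVAlgebra A) {I : Set A} (hI : IsIdeal I) :
    Equivalence (Rel I) where
  refl x := by
    obtain ⟨i, hi⟩ := hI.nonempty
    have h0 : x ⊖ₘ x ∈ I := by
      refine hI.mem_of_le _ _ ?_ hi
      rw [ominus_le_iff h]
      exact le_oplus h _ _
    exact hI.oplus_mem _ _ h0 h0
  symm {x y} hr := by
    rw [rel_iff h hI] at hr ⊢
    exact hr.symm
  trans {x y z} h1 h2 := by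
    rw [rel_iff h hI] at h1 h2 ⊢
    exact ⟨ominus_trans_mem h hI h1.1 h2.1, ominus_trans_mem h hI h2.2 h1.2⟩

theorem rel_oplus (h : IsMVAlgebra A) {I : Set A} (hI : IsIdeal I) {x y a b : A}
    (hxy : Rel I x y) (hab : Rel I a b) : Rel I (x ⊕ₘ a) (y ⊕ₘ b) := by
  rw [rel_iff h hI] at hxy hab ⊢
  exact ⟨oplus_ominus_mem h hI hxy.1 hab.1, oplus_ominus_mem h hI hxy.2 hab.2⟩

theorem rel_neg (h : IsMVAlgebra A) {I : Set A} (hI : IsIdeal I) {x y : A}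
    (hxy : Rel I x y) : Rel I (Sig.neg x) (Sig.neg y) := by
  rw [rel_iff h hI] at hxy ⊢
  rw [neg_ominus_neg h, neg_ominus_neg h]
  exact hxy.symm

theorem rel_mul (h : IsMVWRig A) {I : Set A} (hI : IsIdeal I) {x y a b : A}
    (hxy : Rel I x y) (hab : Rel I a b) : Rel I (x *ₘ a) (y *ₘ b) := by
  have hm := h.toIsMVAlgebra
  refine (rel_equivalence hm hI).trans (y := x *ₘ b) ?_ ?_
  · rw [rel_iff hm hI] at hab ⊢
    exact ⟨mul_ominus_mem h hI x hab.1, mul_ominus_mem h hI x hab.2⟩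
  · rw [rel_iff hm hI] at hxy ⊢
    rw [h.mul_comm x, h.mul_comm y]
    exact ⟨mul_ominus_mem h hI b hxy.1, mul_ominus_mem h hI b hxy.2⟩

end Congruence

/-- The relation `≡_I` as a setoid. -/
def relSetoid {A : Type*} [Sig A] (hA : IsMVWRig A) {I : Set A} (hI : IsIdeal I) : Setoid A :=
  ⟨Rel I, rel_equivalence hA.toIsMVAlgebra hI⟩

/-- The quotient `A/I` of an MVW-rig by an ideal. -/
def Quot {A : Type*} [Sig A] (hA : IsMVWRig A) {I : Set A} (hI : IsIdeal I) : Type _ :=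
  Quotient (relSetoid hA hI)

/-- The class `[x]_I`. -/
def Quot.mk {A : Type*} [Sig A] (hA : IsMVWRig A) {I : Set A} (hI : IsIdeal I) (x : A) :
    Quot hA hI :=
  Quotient.mk (relSetoid hA hI) x

instance {A : Type*} [Sig A] (hA : IsMVWRig A) {I : Set A} (hI : IsIdeal I) :
    Sig (Quot hA hI) where
  zero := Quot.mk hA hI (zer A)
  oplus := Quotient.map₂ Sig.oplus fun _ _ h1 _ _ h2 => rel_oplus hA.toIsMVAlgebra hI h1 h2
  neg := Quotient.map Sig.neg fun _ _ h1 => rel_neg hA.toIsMVAlgebra hI h1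
  mul := Quotient.map₂ Sig.mul fun _ _ h1 _ _ h2 => rel_mul hA hI h1 h2

/-! ### Semi-low lattice-ordered rings with strong unit -/

/-- `(R, u)` is an `l_u`-ring: a commutative ring (not necessarily with `1`) with a lattice order
compatible with addition, in which products of nonnegative elements are nonnegative, and with a
strong unit `u`. -/
structure IsLuRing (R : Type*) [NonUnitalCommRing R] [Lattice R] (u : R) : Prop where
  add_le_add_left : ∀ a b c : R, a ≤ b → c + a ≤ c + b
  mul_nonneg : ∀ a b : R, 0 ≤ a → 0 ≤ b → 0 ≤ a * b
  unit_nonneg : 0 ≤ u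
  exists_abs_le : ∀ x : R, ∃ n : ℕ, |x| ≤ n • u

/-- `(R, u)` is a semi-low `l_u`-ring: `ab ≤ a ∧ b` for all `a, b ∈ [0, u]`. -/
structure IsSemiLow (R : Type*) [NonUnitalCommRing R] [Lattice R] (u : R) : Prop
    extends IsLuRing R u where
  mul_le_inf : ∀ a b : R, 0 ≤ a → a ≤ u → 0 ≤ b → b ≤ u → a * b ≤ a ⊓ b

/-- `l`-ideals of (the additive `l`-group of) `R`. -/
structure LIdeal (R : Type*) [NonUnitalCommRing R] [Lattice R] extends AddSubgroup R where
  mem_of_abs_le : ∀ x y : R, x ∈ carrier → |y| ≤ |x| → y ∈ carrier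

section SemiLow

variable {R : Type*} [NonUnitalCommRing R] [Lattice R] {u : R}

theorem IsSemiLow.isOrderedAddMonoid (hR : IsSemiLow R u) : IsOrderedAddMonoid R where
  add_le_add_left a b h c := by
    rw [add_comm a, add_comm b]
    exact hR.add_le_add_left a b c h

theorem IsSemiLow.mul_le_mul (hR : IsSemiLow R u) {a b c : R} (hc : 0 ≤ c) (h : a ≤ b) :
    c * a ≤ c * b := by
  have := hR.isOrderedAddMonoid
  have := hR.mul_nonneg c (b - a) hc (sub_nonneg.2 h)
  rwa [mul_sub, sub_nonneg] at this

theorem IsSemiLow.unit_mul_le (hR : IsSemiLow R u) (n : ℕ) :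
    ∀ x : R, 0 ≤ x → x ≤ n • u → u * x ≤ x := by
  have := hR.isOrderedAddMonoid
  induction n with
  | zero =>
    intro x h0 h1
    rw [zero_nsmul] at h1
    rw [le_antisymm h1 h0, mul_zero]
  | succ n ih =>
    intro x h0 h1
    have e : x = x ⊓ u + (x - x ⊓ u) := by abel
    have h2 : 0 ≤ x - x ⊓ u := sub_nonneg.2 inf_le_left
    have h3 : x - x ⊓ u ≤ n • u := by
      rw [sub_le_iff_le_add, add_inf]
      refine le_inf ?_ ?_
      · exact le_add_of_nonneg_left (nsmul_nonneg hR.unit_nonneg n)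
      · rwa [← succ_nsmul]
    have h4 : u * (x ⊓ u) ≤ x ⊓ u :=
      (hR.mul_le_inf u (x ⊓ u) hR.unit_nonneg (le_refl u) (le_inf h0 hR.unit_nonneg)
        inf_le_right).trans inf_le_right
    calc u * x = u * (x ⊓ u) + u * (x - x ⊓ u) := by rw [← mul_add, ← e]
      _ ≤ x ⊓ u + (x - x ⊓ u) := add_le_add h4 (ih _ h2 h3)
      _ = x := e.symm

theorem IsSemiLow.mul_le_nsmul (hR : IsSemiLow R u) {r x : R} (n : ℕ) (hr : r ≤ n • u)
    (hx : 0 ≤ x) : x * r ≤ n • x := by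
  have := hR.isOrderedAddMonoid
  obtain ⟨m, hm⟩ := hR.exists_abs_le x
  have h1 : u * x ≤ x := hR.unit_mul_le m x hx ((le_abs_self x).trans hm)
  calc x * r ≤ x * (n • u) := hR.mul_le_mul hx hr
    _ = n • (u * x) := by rw [mul_smul_comm, mul_comm]
    _ ≤ n • x := nsmul_le_nsmul_right h1 n

theorem LIdeal.mul_pos_mem (hR : IsSemiLow R u) (J : LIdeal R) {x r : R}
    (hx : x ∈ J.toAddSubgroup) (hx0 : 0 ≤ x) (hr : 0 ≤ r) : x * r ∈ J.toAddSubgroup := by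
  have := hR.isOrderedAddMonoid
  obtain ⟨n, hn⟩ := hR.exists_abs_le r
  refine J.mem_of_abs_le (n • x) _ (J.toAddSubgroup.nsmul_mem hx n) ?_
  rw [abs_of_nonneg (hR.mul_nonneg _ _ hx0 hr), abs_of_nonneg (nsmul_nonneg hx0 n)]
  exact hR.mul_le_nsmul n ((le_abs_self r).trans hn) hx0

/-- In a semi-low `l_u`-ring `l`-ideals absorb products; this is what makes `R/J` a ring. -/
theorem LIdeal.mul_mem (hR : IsSemiLow R u) (J : LIdeal R) {x : R} (r : R)
    (hx : x ∈ J.toAddSubgroup) : x * r ∈ J.toAddSubgroup := by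
  have := hR.isOrderedAddMonoid
  have hp : x⁺ ∈ J.toAddSubgroup := J.mem_of_abs_le x _ hx (by
    rw [abs_of_nonneg (posPart_nonneg x), ← posPart_add_negPart x]
    exact le_add_of_nonneg_right (negPart_nonneg x))
  have hn : x⁻ ∈ J.toAddSubgroup := J.mem_of_abs_le x _ hx (by
    rw [abs_of_nonneg (negPart_nonneg x), ← posPart_add_negPart x]
    exact le_add_of_nonneg_left (posPart_nonneg x))
  have e : x * r = (x⁺ * r⁺ - x⁺ * r⁻) - (x⁻ * r⁺ - x⁻ * r⁻) := by
    rw [← mul_sub, ← mul_sub, ← sub_mul, posPart_sub_negPart, posPart_sub_negPart]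
  rw [e]
  have P := posPart_nonneg r
  have N := negPart_nonneg r
  exact sub_mem
    (sub_mem (J.mul_pos_mem hR hp (posPart_nonneg x) P) (J.mul_pos_mem hR hp (posPart_nonneg x) N))
    (sub_mem (J.mul_pos_mem hR hn (negPart_nonneg x) P) (J.mul_pos_mem hR hn (negPart_nonneg x) N))

/-- The congruence `x - y ∈ J` of the ring `R`. -/
def LIdeal.ringCon (hR : IsSemiLow R u) (J : LIdeal R) : RingCon R where
  r x y := x - y ∈ J.toAddSubgroup
  iseqv :=
    { refl := fun x => by rw [sub_self]; exact zero_mem _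
      symm := fun {x y} h => by rw [← neg_sub]; exact neg_mem h
      trans := fun {x y z} h1 h2 => by rw [← sub_add_sub_cancel x y z]; exact add_mem h1 h2 }
  add' {w x y z} h1 h2 := by
    show (w + y) - (x + z) ∈ J.toAddSubgroup
    rw [add_sub_add_comm]
    exact add_mem h1 h2
  mul' {w x y z} h1 h2 := by
    show w * y - x * z ∈ J.toAddSubgroup
    have e : w * y - x * z = (w - x) * y + (y - z) * x := by
      rw [sub_mul, sub_mul, mul_comm y x, mul_comm z x]; abel
    rw [e]
    exact add_mem (J.mul_mem hR y h1) (J.mul_mem hR x h2)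

/-- The quotient `R/J` of a semi-low `l_u`-ring by an `l`-ideal. -/
def RQuot (hR : IsSemiLow R u) (J : LIdeal R) : Type _ := (J.ringCon hR).Quotient

/-- The class `[x]_J`. -/
def RQuot.mk (hR : IsSemiLow R u) (J : LIdeal R) (x : R) : RQuot hR J :=
  Quotient.mk (J.ringCon hR).toSetoid x

/-- The ring operations of `R/J` are the ones induced by those of `R`. -/
instance (hR : IsSemiLow R u) (J : LIdeal R) : NonUnitalCommRing (RQuot hR J) :=
  inferInstanceAs (NonUnitalCommRing (J.ringCon hR).Quotient)

theorem LIdeal.sup_sub_sup_mem (hR : IsSemiLow R u) (J : LIdeal R) {w x y z : R}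
    (h1 : w - x ∈ J.toAddSubgroup) (h2 : y - z ∈ J.toAddSubgroup) :
    w ⊔ y - x ⊔ z ∈ J.toAddSubgroup := by
  have := hR.isOrderedAddMonoid
  rw [← sub_add_sub_cancel (w ⊔ y) (x ⊔ y) (x ⊔ z)]
  refine add_mem (J.mem_of_abs_le _ _ h1 (abs_sup_sub_sup_le_abs w x y)) ?_
  rw [sup_comm x y, sup_comm x z]
  exact J.mem_of_abs_le _ _ h2 (abs_sup_sub_sup_le_abs y z x)

theorem LIdeal.inf_sub_inf_mem (hR : IsSemiLow R u) (J : LIdeal R) {w x y z : R}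
    (h1 : w - x ∈ J.toAddSubgroup) (h2 : y - z ∈ J.toAddSubgroup) :
    w ⊓ y - x ⊓ z ∈ J.toAddSubgroup := by
  have := hR.isOrderedAddMonoid
  rw [← sub_add_sub_cancel (w ⊓ y) (x ⊓ y) (x ⊓ z)]
  refine add_mem (J.mem_of_abs_le _ _ h1 (abs_inf_sub_inf_le_abs w x y)) ?_
  rw [inf_comm x y, inf_comm x z]
  exact J.mem_of_abs_le _ _ h2 (abs_inf_sub_inf_le_abs y z x)

instance (hR : IsSemiLow R u) (J : LIdeal R) : Max (RQuot hR J) :=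
  ⟨Quotient.map₂ (· ⊔ ·) fun _ _ h1 _ _ h2 => J.sup_sub_sup_mem hR h1 h2⟩

instance (hR : IsSemiLow R u) (J : LIdeal R) : Min (RQuot hR J) :=
  ⟨Quotient.map₂ (· ⊓ ·) fun _ _ h1 _ _ h2 => J.inf_sub_inf_mem hR h1 h2⟩

/-- The lattice structure of `R/J`: `[x] ∨ [y] = [x ∨ y]`, `[x] ∧ [y] = [x ∧ y]`, with the
corresponding order `a ≤ b ↔ a ∨ b = b`. -/
instance (hR : IsSemiLow R u) (J : LIdeal R) : Lattice (RQuot hR J) :=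
  Lattice.mk'
    (by rintro ⟨a⟩ ⟨b⟩; exact congrArg (RQuot.mk hR J) (sup_comm a b))
    (by rintro ⟨a⟩ ⟨b⟩ ⟨c⟩; exact congrArg (RQuot.mk hR J) (sup_assoc a b c))
    (by rintro ⟨a⟩ ⟨b⟩; exact congrArg (RQuot.mk hR J) (inf_comm a b))
    (by rintro ⟨a⟩ ⟨b⟩ ⟨c⟩; exact congrArg (RQuot.mk hR J) (inf_assoc a b c))
    (by rintro ⟨a⟩ ⟨b⟩; exact congrArg (RQuot.mk hR J) (sup_inf_self (a := a) (b := b)))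
    (by rintro ⟨a⟩ ⟨b⟩; exact congrArg (RQuot.mk hR J) (inf_sup_self (a := a) (b := b)))

theorem RQuot.mk_le_mk (hR : IsSemiLow R u) (J : LIdeal R) {x y : R} (h : x ≤ y) :
    RQuot.mk hR J x ≤ RQuot.mk hR J y :=
  sup_eq_right.1 (congrArg (RQuot.mk hR J) (sup_eq_right.2 h))

/-- An `l`-ideal `J` is prime iff `R/J` is a chain. -/
def LIdeal.IsPrime (hR : IsSemiLow R u) (J : LIdeal R) : Prop :=
  ∀ a b : RQuot hR J, a ≤ b ∨ b ≤ a

/-- `Γ(R, u) = [0, u]`. -/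
def Gamma (_ : IsSemiLow R u) : Type _ := {x : R // 0 ≤ x ∧ x ≤ u}

/-- The operations of `Γ(R, u)`: `x ⊕ y = (x + y) ∧ u`, `¬x = u - x`, and the product of `R`. -/
instance (hR : IsSemiLow R u) : Sig (Gamma hR) where
  zero := ⟨0, le_refl 0, hR.unit_nonneg⟩
  oplus x y := ⟨(x.1 + y.1) ⊓ u, by
    have := hR.isOrderedAddMonoid
    exact ⟨le_inf (add_nonneg x.2.1 y.2.1) hR.unit_nonneg, inf_le_right⟩⟩
  neg x := ⟨u - x.1, by
    have := hR.isOrderedAddMonoid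
    exact ⟨sub_nonneg.2 x.2.2, sub_le_self u x.2.1⟩⟩
  mul x y := ⟨x.1 * y.1, hR.mul_nonneg _ _ x.2.1 y.2.1,
    ((hR.mul_le_inf _ _ x.2.1 x.2.2 y.2.1 y.2.2).trans inf_le_left).trans x.2.2⟩

/-- The subset `J ∩ [0, u]` of `Γ(R, u)`. -/
def LIdeal.segment (J : LIdeal R) (hR : IsSemiLow R u) : Set (Gamma hR) :=
  {x | x.1 ∈ J.toAddSubgroup}

/-- The class `[x]_J`, for `x ∈ [0, u]`, as an element of `Γ(R/J, [u]_J)`. -/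
def Gamma.mk (hR : IsSemiLow R u) (J : LIdeal R)
    (hQ : IsSemiLow (RQuot hR J) (RQuot.mk hR J u)) (x : Gamma hR) : Gamma hQ :=
  ⟨RQuot.mk hR J x.1, RQuot.mk_le_mk hR J x.2.1, RQuot.mk_le_mk hR J x.2.2⟩

end SemiLow

end PMV

/-! In `Γ(R, u)` the operation `⊖` is the positive part of the difference (`Gamma.ominus_val`). The
law `a(b ⊖ c) = ab ⊖ ac` thus says that multiplication by `a ∈ [0, u]` preserves positive parts;
semi-lowness gives it, since `a` shrinks the disjoint elements `(b - c)⁺` and `(b - c)⁻`, which stay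
disjoint (`IsSemiLow.mul_sub_sup_zero`).

The congruence of `J ∩ [0, u]` is `x - y ∈ J` on `[0, u]` (`LIdeal.rel_segment_iff`), and each class
between `0` and `[u]_J` has a representative in `[0, u]`, obtained by truncation
(`RQuot.exists_mem_segment`). So both algebras are `[0, u]` modulo the same relation. The map is
built from the quotient of `Γ(R, u)`, where it can be defined on representatives, and `Θ` is its
inverse. -/

namespace PMV

/-! ### Quotients of `PMV_f`-algebras -/

section Quotient

variable {A : Type*} [Sig A]

/-- Quotients of `PMV_f`-algebras by ideals are `PMV_f`-algebras. -/
theorem IsPMVf.quot (h : IsPMVf A) {I : Set A} (hI : IsIdeal I) :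
    IsPMVf (Quot h.toIsMVWRig hI) where
  oplus_assoc := by
    rintro ⟨x⟩ ⟨y⟩ ⟨z⟩; exact congrArg (Quot.mk h.toIsMVWRig hI) (h.oplus_assoc x y z)
  oplus_comm := by
    rintro ⟨x⟩ ⟨y⟩; exact congrArg (Quot.mk h.toIsMVWRig hI) (h.oplus_comm x y)
  oplus_zero := by
    rintro ⟨x⟩; exact congrArg (Quot.mk h.toIsMVWRig hI) (h.oplus_zero x)
  neg_neg := by
    rintro ⟨x⟩; exact congrArg (Quot.mk h.toIsMVWRig hI) (h.neg_neg x)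
  oplus_unit := by
    rintro ⟨x⟩; exact congrArg (Quot.mk h.toIsMVWRig hI) (h.oplus_unit x)
  lukasiewicz := by
    rintro ⟨x⟩ ⟨y⟩; exact congrArg (Quot.mk h.toIsMVWRig hI) (h.lukasiewicz x y)
  mul_assoc := by
    rintro ⟨x⟩ ⟨y⟩ ⟨z⟩; exact congrArg (Quot.mk h.toIsMVWRig hI) (h.mul_assoc x y z)
  mul_comm := by
    rintro ⟨x⟩ ⟨y⟩; exact congrArg (Quot.mk h.toIsMVWRig hI) (h.mul_comm x y)
  mul_zero := by
    rintro ⟨x⟩; exact congrArg (Quot.mk h.toIsMVWRig hI) (h.mul_zero x)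
  mul_oplus_le := by
    -- `≤ₘ` is by definition an equation with right side `zer`, so inequalities descend exactly as
    -- identities do.
    rintro ⟨x⟩ ⟨y⟩ ⟨z⟩; exact congrArg (Quot.mk h.toIsMVWRig hI) (h.mul_oplus_le x y z)
  ominus_le_mul := by
    rintro ⟨x⟩ ⟨y⟩ ⟨z⟩; exact congrArg (Quot.mk h.toIsMVWRig hI) (h.ominus_le_mul x y z)
  mul_le_inf := by
    rintro ⟨x⟩ ⟨y⟩; exact congrArg (Quot.mk h.toIsMVWRig hI) (h.mul_le_inf x y)
  mul_ominus := by
    rintro ⟨x⟩ ⟨y⟩ ⟨z⟩; exact congrArg (Quot.mk h.toIsMVWRig hI) (h.mul_ominus x y z)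

end Quotient

/-! ### Isomorphisms and the order -/

section Iso

variable {A B : Type*} [Sig A] [Sig B]

theorem Iso.map_ominus (e : Iso A B) (x y : A) : e.toEquiv (x ⊖ₘ y) = e.toEquiv x ⊖ₘ e.toEquiv y :=
  (e.map_neg _).trans (congrArg Sig.neg ((e.map_oplus _ _).trans
    (congrArg (fun z => Sig.oplus z (e.toEquiv y)) (e.map_neg x))))

/-- The order is an equation between `⊖` and `0`, so injectivity reflects it. This carries totality
across the isomorphism. -/
theorem Iso.map_le_iff (e : Iso A B) (x y : A) : e.toEquiv x ≤ₘ e.toEquiv y ↔ x ≤ₘ y := by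
  unfold le
  have h0 : e.toEquiv (zer A) = zer B := e.map_zero
  rw [← e.map_ominus, ← h0, e.toEquiv.injective.eq_iff]

/-- The inverse of an isomorphism. -/
def Iso.symm (e : Iso A B) : Iso B A where
  toEquiv := e.toEquiv.symm
  map_zero := e.toEquiv.symm_apply_eq.2 e.map_zero.symm
  map_oplus x y := e.toEquiv.symm_apply_eq.2 (by
    refine Eq.trans ?_ (e.map_oplus _ _).symm
    exact congrArg₂ Sig.oplus (e.toEquiv.apply_symm_apply x).symm
      (e.toEquiv.apply_symm_apply y).symm)
  map_neg x := e.toEquiv.symm_apply_eq.2 (by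
    refine Eq.trans ?_ (e.map_neg _).symm
    exact congrArg Sig.neg (e.toEquiv.apply_symm_apply x).symm)
  map_mul x y := e.toEquiv.symm_apply_eq.2 (by
    refine Eq.trans ?_ (e.map_mul _ _).symm
    exact congrArg₂ Sig.mul (e.toEquiv.apply_symm_apply x).symm
      (e.toEquiv.apply_symm_apply y).symm)

end Iso

/-! ### The segment `[0, u]` as a `PMV_f`-algebra, and its ideal `J ∩ [0, u]` -/

section Gamma

variable {R : Type*} [NonUnitalCommRing R] [Lattice R] {u : R}

theorem Gamma.ominus_val (hR : IsSemiLow R u) (x y : Gamma hR) :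
    (x ⊖ₘ y).1 = (x.1 - y.1) ⊔ 0 := by
  have := hR.isOrderedAddMonoid
  show u - ((u - x.1 + y.1) ⊓ u) = _
  rw [sub_inf, sub_self]
  congr 1
  abel

theorem Gamma.le_iff (hR : IsSemiLow R u) (x y : Gamma hR) : x ≤ₘ y ↔ x.1 ≤ y.1 := by
  have := hR.isOrderedAddMonoid
  refine (show x ≤ₘ y ↔ (x ⊖ₘ y).1 = (zer (Gamma hR)).1 from Subtype.ext_iff).trans ?_
  rw [Gamma.ominus_val]
  show (x.1 - y.1) ⊔ 0 = 0 ↔ _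
  rw [sup_eq_right, sub_nonpos]

/-- `x - (x - y)⁺` equals `y ⊓ x`, which is nonnegative, so the outer truncation has no effect. -/
theorem Gamma.inf_val (hR : IsSemiLow R u) (x y : Gamma hR) : (x ⊓ₘ y).1 = x.1 ⊓ y.1 := by
  have := hR.isOrderedAddMonoid
  unfold inf
  rw [Gamma.ominus_val, Gamma.ominus_val, sub_sup, sub_zero, sub_sub_cancel,
    sup_eq_left.2 (le_inf y.2.1 x.2.1), inf_comm]

/-- Multiplication by an element of `[0, u]` preserves positive parts of differences in `[0, u]`. -/
theorem IsSemiLow.mul_sub_sup_zero (hR : IsSemiLow R u) {a b c : R} (ha : 0 ≤ a) (hau : a ≤ u)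
    (hb : 0 ≤ b) (hbu : b ≤ u) (hc : 0 ≤ c) (hcu : c ≤ u) :
    a * ((b - c) ⊔ 0) = (a * b - a * c) ⊔ 0 := by
  have := hR.isOrderedAddMonoid
  have hp0 : 0 ≤ (b - c)⁺ := posPart_nonneg _
  have hn0 : 0 ≤ (b - c)⁻ := negPart_nonneg _
  -- Both parts must lie in `[0, u]`, the only range where semi-lowness applies.
  have hpu : (b - c)⁺ ≤ u := sup_le ((sub_le_self b hc).trans hbu) hR.unit_nonneg
  have hnu : (b - c)⁻ ≤ u :=
    sup_le (by rw [neg_sub]; exact (sub_le_self c hb).trans hcu) hR.unit_nonneg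
  have hinf : a * (b - c)⁺ ⊓ a * (b - c)⁻ = 0 := by
    refine le_antisymm ?_ (le_inf (hR.mul_nonneg _ _ ha hp0) (hR.mul_nonneg _ _ ha hn0))
    rw [← posPart_inf_negPart_eq_zero (b - c)]
    exact inf_le_inf ((hR.mul_le_inf _ _ ha hau hp0 hpu).trans inf_le_right)
      ((hR.mul_le_inf _ _ ha hau hn0 hnu).trans inf_le_right)
  have e : a * b - a * c = a * (b - c)⁺ - a * (b - c)⁻ := by
    rw [← mul_sub, ← mul_sub, posPart_sub_negPart]
  -- With `p = a(b - c)⁺` and `q = a(b - c)⁻`: `p - p ⊓ q = 0 ⊔ (p - q)`, so `p ⊓ q = 0` gives `p =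
  -- (p - q)⁺`.
  have e2 := sub_inf (a * (b - c)⁺) (a * (b - c)⁻) (a * (b - c)⁺)
  rw [hinf, sub_zero, sub_self] at e2
  rw [e, sup_comm (a * (b - c)⁺ - _), ← e2]
  rfl

/-- `Γ(R, u)` is a `PMV_f`-algebra. -/
theorem IsSemiLow.isPMVf_gamma (hR : IsSemiLow R u) : IsPMVf (Gamma hR) := by
  have := hR.isOrderedAddMonoid
  have key : ∀ a b c : Gamma hR, a *ₘ (b ⊖ₘ c) = a *ₘ b ⊖ₘ a *ₘ c := fun a b c => by
    refine Subtype.ext ?_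
    rw [Gamma.ominus_val]
    show a.1 * (b ⊖ₘ c).1 = _
    rw [Gamma.ominus_val]
    exact hR.mul_sub_sup_zero a.2.1 a.2.2 b.2.1 b.2.2 c.2.1 c.2.2
  exact {
    oplus_assoc := fun x y z => Subtype.ext <| by
      show ((x.1 + y.1) ⊓ u + z.1) ⊓ u = (x.1 + (y.1 + z.1) ⊓ u) ⊓ u
      -- Both sides become `(x + y + z) ⊓ u`: the inner caps `u + z` and `x + u` are at least `u`.
      rw [inf_add, add_inf, inf_assoc, inf_assoc, add_assoc,
        inf_eq_right.2 (le_add_of_nonneg_right z.2.1 : u ≤ u + z.1),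
        inf_eq_right.2 (le_add_of_nonneg_left x.2.1 : u ≤ x.1 + u)]
    oplus_comm := fun x y => Subtype.ext <| by
      show (x.1 + y.1) ⊓ u = (y.1 + x.1) ⊓ u
      rw [add_comm]
    oplus_zero := fun x => Subtype.ext <| by
      show (x.1 + 0) ⊓ u = x.1
      rw [add_zero, inf_eq_left.2 x.2.2]
    neg_neg := fun x => Subtype.ext (sub_sub_cancel u x.1)
    oplus_unit := fun x => Subtype.ext <| by
      show (x.1 + (u - 0)) ⊓ u = u - 0
      rw [sub_zero, inf_eq_right]
      exact le_add_of_nonneg_left x.2.1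
    lukasiewicz := fun x y => Subtype.ext <| by
      -- Each side is `(x ⊔ y) ⊓ u`, since `(x - y)⁺ + y = x ⊔ y`.
      show ((x ⊖ₘ y).1 + y.1) ⊓ u = ((y ⊖ₘ x).1 + x.1) ⊓ u
      rw [Gamma.ominus_val, Gamma.ominus_val, sup_add, sup_add, sub_add_cancel, sub_add_cancel,
        zero_add, zero_add, sup_comm]
    mul_assoc := fun a b c => Subtype.ext (mul_assoc a.1 b.1 c.1)
    mul_comm := fun a b => Subtype.ext (mul_comm a.1 b.1)
    mul_zero := fun a => Subtype.ext (mul_zero a.1)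
    mul_oplus_le := fun a b c => by
      rw [Gamma.le_iff]
      refine le_inf ?_ (a *ₘ (b ⊕ₘ c)).2.2
      show a.1 * ((b.1 + c.1) ⊓ u) ≤ a.1 * b.1 + a.1 * c.1
      rw [← mul_add]
      exact hR.mul_le_mul a.2.1 inf_le_left
    ominus_le_mul := fun a b c => by
      rw [key, Gamma.le_iff]
    mul_le_inf := fun a b => by
      rw [Gamma.le_iff, Gamma.inf_val]
      exact hR.mul_le_inf _ _ a.2.1 a.2.2 b.2.1 b.2.2
    mul_ominus := key }

/-- If `R` is totally ordered, then `Γ(R, u)` is a `PMV_f`-chain. -/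
theorem IsSemiLow.isPMVfChain_gamma (hR : IsSemiLow R u) (h : ∀ a b : R, a ≤ b ∨ b ≤ a) :
    IsPMVfChain (Gamma hR) where
  toIsPMVf := hR.isPMVf_gamma
  total a b := by
    rw [Gamma.le_iff, Gamma.le_iff]
    exact h a.1 b.1

theorem LIdeal.mem_of_le (hR : IsSemiLow R u) (J : LIdeal R) {x y : R} (hx : x ∈ J.toAddSubgroup)
    (hy : 0 ≤ y) (hyx : y ≤ x) : y ∈ J.toAddSubgroup := by
  have := hR.isOrderedAddMonoid
  refine J.mem_of_abs_le x y hx ?_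
  rwa [abs_of_nonneg hy, abs_of_nonneg (hy.trans hyx)]

/-- `J ∩ [0, u]` is an ideal of `Γ(R, u)`. -/
theorem LIdeal.isIdeal_segment (hR : IsSemiLow R u) (J : LIdeal R) : IsIdeal (J.segment hR) where
  nonempty := ⟨zer (Gamma hR), zero_mem J.toAddSubgroup⟩
  mem_of_le a b hab hb := J.mem_of_le hR hb a.2.1 ((Gamma.le_iff hR a b).1 hab)
  oplus_mem a b ha hb := J.mem_of_le hR (add_mem ha hb) (a ⊕ₘ b).2.1 inf_le_left
  mul_mem _ b ha := J.mul_mem hR b.1 ha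

/-- One direction is `x = x⁺ - x⁻`. For the other, `⊔ 0` respects congruence modulo `J` and fixes
`0`. -/
theorem LIdeal.sup_zero_mem_iff (hR : IsSemiLow R u) (J : LIdeal R) (x : R) :
    x ⊔ 0 ∈ J.toAddSubgroup ∧ -x ⊔ 0 ∈ J.toAddSubgroup ↔ x ∈ J.toAddSubgroup := by
  have := hR.isOrderedAddMonoid
  refine ⟨fun h => ?_, fun h => ?_⟩
  · rw [← posPart_sub_negPart x]
    exact sub_mem h.1 h.2
  · have aux : ∀ y ∈ J.toAddSubgroup, y ⊔ 0 ∈ J.toAddSubgroup := fun y hy => by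
      simpa using J.sup_sub_sup_mem hR (w := y) (x := 0) (y := 0) (z := 0)
        (by simpa using hy) (by simp [zero_mem])
    exact ⟨aux x h, aux (-x) (neg_mem h)⟩

/-- `x ⊖ y` and `y ⊖ x` are the positive and negative parts of `x - y`. -/
theorem LIdeal.rel_segment_iff (hR : IsSemiLow R u) (J : LIdeal R) (x y : Gamma hR) :
    Rel (J.segment hR) x y ↔ x.1 - y.1 ∈ J.toAddSubgroup := by
  rw [rel_iff hR.isPMVf_gamma.toIsMVAlgebra (J.isIdeal_segment hR)]
  show (x ⊖ₘ y).1 ∈ J.toAddSubgroup ∧ (y ⊖ₘ x).1 ∈ J.toAddSubgroup ↔ _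
  rw [Gamma.ominus_val, Gamma.ominus_val, ← neg_sub x.1 y.1]
  exact J.sup_zero_mem_iff hR _

end Gamma

/-! ### The quotient `R/J` and the isomorphism -/

section RQuot

variable {R : Type*} [NonUnitalCommRing R] [Lattice R] {u : R}

theorem RQuot.mk_eq_mk_iff (hR : IsSemiLow R u) (J : LIdeal R) {x y : R} :
    RQuot.mk hR J x = RQuot.mk hR J y ↔ x - y ∈ J.toAddSubgroup :=
  Quotient.eq (r := (J.ringCon hR).toSetoid)

theorem RQuot.mk_surjective (hR : IsSemiLow R u) (J : LIdeal R) :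
    Function.Surjective (RQuot.mk hR J) := Quotient.mk_surjective

/-- Replacing a representative `x` by `x ⊔ 0` keeps the class, as `[x ⊔ 0] = [x] ⊔ 0`. -/
theorem RQuot.exists_nonneg (hR : IsSemiLow R u) (J : LIdeal R) {a : RQuot hR J} (h : 0 ≤ a) :
    ∃ x : R, 0 ≤ x ∧ RQuot.mk hR J x = a := by
  obtain ⟨x, rfl⟩ := RQuot.mk_surjective hR J a
  refine ⟨x ⊔ 0, le_sup_right, ?_⟩
  show RQuot.mk hR J x ⊔ 0 = RQuot.mk hR J x
  exact sup_eq_left.2 h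

theorem RQuot.exists_mem_segment (hR : IsSemiLow R u) (J : LIdeal R) {a : RQuot hR J} (h : 0 ≤ a)
    (hu : a ≤ RQuot.mk hR J u) : ∃ x : R, (0 ≤ x ∧ x ≤ u) ∧ RQuot.mk hR J x = a := by
  obtain ⟨x, hx, rfl⟩ := RQuot.exists_nonneg hR J h
  refine ⟨x ⊓ u, ⟨le_inf hx hR.unit_nonneg, inf_le_right⟩, ?_⟩
  show RQuot.mk hR J x ⊓ RQuot.mk hR J u = RQuot.mk hR J x
  exact inf_eq_left.2 hu

/-- `(R/J, [u])` is a semi-low `l_u`-ring. -/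
theorem IsSemiLow.rQuot (hR : IsSemiLow R u) (J : LIdeal R) :
    IsSemiLow (RQuot hR J) (RQuot.mk hR J u) where
  add_le_add_left a b c h := by
    have := hR.isOrderedAddMonoid
    obtain ⟨x, rfl⟩ := RQuot.mk_surjective hR J a
    obtain ⟨y, rfl⟩ := RQuot.mk_surjective hR J b
    obtain ⟨z, rfl⟩ := RQuot.mk_surjective hR J c
    -- The order of `R/J` comes from `⊔`; as an equation it is preserved by translation.
    rw [← sup_eq_right] at h ⊢
    calc RQuot.mk hR J ((z + x) ⊔ (z + y))
        = RQuot.mk hR J (z + x ⊔ y) := by rw [add_sup]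
      _ = RQuot.mk hR J z + (RQuot.mk hR J x ⊔ RQuot.mk hR J y) := rfl
      _ = _ := congrArg (RQuot.mk hR J z + ·) h
  mul_nonneg a b ha hb := by
    obtain ⟨x, hx, rfl⟩ := RQuot.exists_nonneg hR J ha
    obtain ⟨y, hy, rfl⟩ := RQuot.exists_nonneg hR J hb
    exact RQuot.mk_le_mk hR J (hR.mul_nonneg x y hx hy)
  unit_nonneg := RQuot.mk_le_mk hR J hR.unit_nonneg
  exists_abs_le a := by
    obtain ⟨x, rfl⟩ := RQuot.mk_surjective hR J a
    obtain ⟨n, hn⟩ := hR.exists_abs_le x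
    -- `|[x]|` and `n • [u]` are by definition the classes of `|x|` and `n • u`.
    exact ⟨n, RQuot.mk_le_mk hR J hn⟩
  mul_le_inf a b ha hau hb hbu := by
    obtain ⟨x, hx, rfl⟩ := RQuot.exists_mem_segment hR J ha hau
    obtain ⟨y, hy, rfl⟩ := RQuot.exists_mem_segment hR J hb hbu
    exact RQuot.mk_le_mk hR J (hR.mul_le_inf x y hx.1 hx.2 hy.1 hy.2)

theorem Gamma.mk_surjective (hR : IsSemiLow R u) (J : LIdeal R) :
    Function.Surjective (Gamma.mk hR J (hR.rQuot J)) := fun a => by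
  obtain ⟨x, hx, h⟩ := RQuot.exists_mem_segment hR J a.2.1 a.2.2
  exact ⟨⟨x, hx⟩, Subtype.ext h⟩

theorem Gamma.mk_eq_mk_iff (hR : IsSemiLow R u) (J : LIdeal R) (x y : Gamma hR) :
    Gamma.mk hR J (hR.rQuot J) x = Gamma.mk hR J (hR.rQuot J) y ↔ Rel (J.segment hR) x y := by
  rw [J.rel_segment_iff hR, ← RQuot.mk_eq_mk_iff]
  exact Subtype.ext_iff

/-- The map `[x] ↦ [x]_J` from `Γ(R, u)/(J ∩ [0, u])` to `Γ(R/J, [u]_J)`. -/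
def Gamma.ofQuot (hR : IsSemiLow R u) (J : LIdeal R) :
    Quot hR.isPMVf_gamma.toIsMVWRig (J.isIdeal_segment hR) → Gamma (hR.rQuot J) :=
  Quotient.lift (Gamma.mk hR J (hR.rQuot J)) fun x y h => (Gamma.mk_eq_mk_iff hR J x y).2 h

theorem Gamma.ofQuot_bijective (hR : IsSemiLow R u) (J : LIdeal R) :
    Function.Bijective (Gamma.ofQuot hR J) := by
  refine ⟨?_, fun a => ?_⟩
  · rintro ⟨x⟩ ⟨y⟩ h
    exact Quotient.sound ((Gamma.mk_eq_mk_iff hR J x y).1 h)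
  · obtain ⟨x, rfl⟩ := Gamma.mk_surjective hR J a
    exact ⟨Quot.mk _ _ x, rfl⟩

/-- The isomorphism `[x] ↦ [x]_J` from `Γ(R, u)/(J ∩ [0, u])` to `Γ(R/J, [u]_J)`. -/
noncomputable def Gamma.quotIso (hR : IsSemiLow R u) (J : LIdeal R) :
    Iso (Quot hR.isPMVf_gamma.toIsMVWRig (J.isIdeal_segment hR)) (Gamma (hR.rQuot J)) where
  toEquiv := Equiv.ofBijective (Gamma.ofQuot hR J) (Gamma.ofQuot_bijective hR J)
  map_zero := rfl
  map_oplus := by rintro ⟨x⟩ ⟨y⟩; rfl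
  map_neg := by rintro ⟨x⟩; rfl
  map_mul := by rintro ⟨x⟩ ⟨y⟩; rfl

end RQuot

end PMV

theorem mainTheorem9 {R : Type*} [NonUnitalCommRing R] [Lattice R] {u : R}
    (hR : PMV.IsSemiLow R u) (J : PMV.LIdeal R) :
    ∃ (hQ : PMV.IsSemiLow (PMV.RQuot hR J) (PMV.RQuot.mk hR J u))
      (hA : PMV.IsPMVf (PMV.Gamma hR))
      (hI : PMV.IsIdeal (J.segment hR)),
      PMV.IsPMVf (PMV.Gamma hQ) ∧
      PMV.IsPMVf (PMV.Quot hA.toIsMVWRig hI) ∧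
      (∃ Θ : PMV.Iso (PMV.Gamma hQ) (PMV.Quot hA.toIsMVWRig hI),
        ∀ x : PMV.Gamma hR,
          Θ.toEquiv (PMV.Gamma.mk hR J hQ x) = PMV.Quot.mk hA.toIsMVWRig hI x) ∧
      (J.IsPrime hR →
        PMV.IsPMVfChain (PMV.Gamma hQ) ∧ PMV.IsPMVfChain (PMV.Quot hA.toIsMVWRig hI)) := by
  refine ⟨hR.rQuot J, hR.isPMVf_gamma, J.isIdeal_segment hR, (hR.rQuot J).isPMVf_gamma,
    hR.isPMVf_gamma.quot _, ⟨(PMV.Gamma.quotIso hR J).symm, fun x => ?_⟩, fun hJ => ?_⟩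
  -- As `Θ` is an inverse, its formula is equivalent to the defining rule of `Gamma.ofQuot`.
  · exact (PMV.Gamma.quotIso hR J).toEquiv.symm_apply_eq.2 rfl
  · have hc := (hR.rQuot J).isPMVfChain_gamma hJ
    refine ⟨hc, hR.isPMVf_gamma.quot _, fun a b => ?_⟩
    rw [← (PMV.Gamma.quotIso hR J).map_le_iff, ← (PMV.Gamma.quotIso hR J).map_le_iff b a]
    exact hc.total _ _
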